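/- Let $k\ge 1$ be an integer and let $G$ be a finite simple non-bipartite graph of order $n\ge 2k+4$ with edge set $E_G$, such that $G$ contains no odd cycle of length at most $2k+1$, i.e. none of $C_3,C_5,\ldots,C_{2k+1}$ is a subgraph of $G$. For a finite graph $H$ let $\lambda_1(H)$ denote the largest eigenvalue of its adjacency matrix, and for $s,t\ge 1$ let $R_k(K_{s,t})$ denote the graph obtained from the complete bipartite graph $K_{s,t}$ by replacing one of its edges $uv$ with a path $P_{2k+1}$ on $2k+1$ vertices (that is, the edge $uv$ is deleted, and $u$ and $v$ are joined by a path with $2k-1$ new internal vertices); up to isomorphism it does not depend on the choice of the edge. Then $$|E_G|<\frac n2\,\lambda_1\!\left(R_k\!\left(K_{\lfloor (n-2k+1)/2\rfloor,\ \lceil (n-2k+1)/2\rceil}\right)\right).$$ -/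

import Mathlib

/-- The largest eigenvalue `λ₁(G)` of the adjacency matrix of a finite graph `G`. -/
noncomputable def lambdaOne {V : Type*} [Fintype V] (G : SimpleGraph V) : ℝ :=
  open Classical in
  sSup {μ : ℝ | Module.End.HasEigenvalue (Matrix.toLin' (G.adjMatrix ℝ)) μ}

/-- The supremum in `lambdaOne` is a maximum: `lambdaOne G` is the largest eigenvalue. -/
theorem lambdaOne_isGreatest {V : Type*} [Fintype V] [Nonempty V] [DecidableEq V]
    (G : SimpleGraph V) [DecidableRel G.Adj] :
    IsGreatest {μ : ℝ | Module.End.HasEigenvalue (Matrix.toLin' (G.adjMatrix ℝ)) μ}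
      (lambdaOne G) := by
  have hfin : {μ : ℝ |
      Module.End.HasEigenvalue (Matrix.toLin' (G.adjMatrix ℝ)) μ}.Finite :=
    Module.End.finite_hasEigenvalue _
  have hA : (G.adjMatrix ℝ).IsHermitian := by
    rw [Matrix.IsHermitian, Matrix.conjTranspose_eq_transpose_of_trivial]
    exact G.isSymm_adjMatrix
  have hne : {μ : ℝ |
      Module.End.HasEigenvalue (Matrix.toLin' (G.adjMatrix ℝ)) μ}.Nonempty := by
    obtain ⟨i⟩ := ‹Nonempty V›
    refine ⟨hA.eigenvalues i, ?_⟩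
    have h := hA.eigenvalues_mem_spectrum_real i
    rw [← Matrix.spectrum_toLin'] at h
    exact Module.End.hasEigenvalue_iff_mem_spectrum.2 h
  have h := hne.csSup_mem hfin
  have heq : lambdaOne G =
      sSup {μ : ℝ | Module.End.HasEigenvalue (Matrix.toLin' (G.adjMatrix ℝ)) μ} := by
    unfold lambdaOne
    congr!
  rw [heq]
  exact ⟨h, fun x hx => le_csSup hfin.bddAbove hx⟩

/-- The graph obtained from `H` by replacing the edge `ab` with a path
`a, x₀, x₁, …, xₘ₋₁, b` having `m ≥ 1` new internal vertices `xᵢ`: the edge `ab` is deleted,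
and the path, of order `m + 2`, is glued in between `a` and `b`. -/
def replaceEdgeByPath {W : Type*} (H : SimpleGraph W) (a b : W) (m : ℕ) :
    SimpleGraph (W ⊕ Fin m) where
  Adj
    | .inl x, .inl y => H.Adj x y ∧ s(x, y) ≠ s(a, b)
    | .inl x, .inr i => (x = a ∧ (i : ℕ) = 0) ∨ (x = b ∧ (i : ℕ) + 1 = m)
    | .inr i, .inl x => (x = a ∧ (i : ℕ) = 0) ∨ (x = b ∧ (i : ℕ) + 1 = m)
    | .inr i, .inr j => (i : ℕ) + 1 = j ∨ (j : ℕ) + 1 = i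
  symm := ⟨by
    rintro (x | i) (y | j) h
    · exact ⟨h.1.symm, by rw [Sym2.eq_swap]; exact h.2⟩
    · exact h
    · exact h
    · exact h.symm⟩
  loopless := ⟨by
    rintro (x | i) h
    · exact H.loopless.irrefl x h.1
    · rcases h with h | h <;> omega⟩

/-- `R_k(K_{s,t})` for `k ≥ 1`: the edge `uv` of the complete bipartite graph `K_{s,t}` is replaced
with a path `P_{2k+1}` of order `2k + 1`, hence with `2k - 1` new internal vertices. All choices
of the edge `uv` give isomorphic graphs. -/
def graphR (k : ℕ) {s t : ℕ} (u : Fin s) (v : Fin t) :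
    SimpleGraph ((Fin s ⊕ Fin t) ⊕ Fin (2 * k - 1)) :=
  replaceEdgeByPath (completeBipartiteGraph (Fin s) (Fin t)) (Sum.inl u) (Sum.inr v) (2 * k - 1)

/-! The number of edges of `R_k(K_{s,t})` separates the two sides. That graph has `n` vertices and
is not regular, so its average degree is below `λ₁`, which gives `st + 2k - 1 < (n/2) λ₁`.
Conversely `G` has at most `st + 2k - 1` edges. A shortest odd closed walk is a cycle `C` of length
`L ≥ 2k + 3`, and minimality leaves every vertex at most two neighbors on `C`. So at most `L + 2(n -
L)` edges meet `C`, and Mantel's theorem bounds the rest by `(n - L)²/4`. At `L = 2k + 3` the total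
is exactly `st + 2k - 1`. -/

namespace SimpleGraph

/-! ### Average degree and spectral radius -/

/-- For a nonregular graph, the average degree is less than the largest adjacency eigenvalue. -/
theorem sum_degree_lt_card_mul_lambdaOne {V : Type*} [Fintype V] [DecidableEq V]
    (G : SimpleGraph V) [DecidableRel G.Adj] {a b : V} (hab : G.degree a ≠ G.degree b) :
    ((∑ x, G.degree x : ℕ) : ℝ) < Fintype.card V * lambdaOne G := by
  have : Nonempty V := ⟨a⟩
  have hgr := lambdaOne_isGreatest G
  set l := lambdaOne G
  set M : Matrix V V ℝ := Matrix.diagonal (fun _ => l) - G.adjMatrix ℝ with hM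
  have hMH : M.IsHermitian := by
    rw [Matrix.IsHermitian, Matrix.conjTranspose_eq_transpose_of_trivial, hM,
      Matrix.transpose_sub, Matrix.diagonal_transpose, G.isSymm_adjMatrix]
  have hmul (x : V → ℝ) : M.mulVec x = l • x - (G.adjMatrix ℝ).mulVec x := by
    rw [hM, Matrix.sub_mulVec]
    congr 1
    ext i
    simp [Matrix.mulVec_diagonal]
  have hpsd : M.PosSemidef := by
    rw [hMH.posSemidef_iff_eigenvalues_nonneg]
    intro i
    have h1 := hMH.eigenvalues_mem_spectrum_real i
    rw [← Matrix.spectrum_toLin', ← Module.End.hasEigenvalue_iff_mem_spectrum] at h1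
    obtain ⟨x, hx⟩ := h1.exists_hasEigenvector
    have h2 : Module.End.HasEigenvalue (Matrix.toLin' (G.adjMatrix ℝ))
        (l - hMH.eigenvalues i) := by
      refine Module.End.hasEigenvalue_of_hasEigenvector (x := x)
        ⟨Module.End.mem_eigenspace_iff.2 ?_, hx.2⟩
      have h3 := hx.apply_eq_smul
      rw [Matrix.toLin'_apply, hmul] at h3
      rw [Matrix.toLin'_apply, sub_smul, ← h3]
      abel
    have := hgr.2 h2
    simp only [Pi.zero_apply]
    linarith
  have hone : M.mulVec 1 = fun x => l - G.degree x := by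
    ext x
    rw [hmul]
    simp only [Pi.sub_apply, Pi.smul_apply, Pi.one_apply, smul_eq_mul, mul_one, sub_right_inj]
    simp
  have hnn := hpsd.dotProduct_mulVec_nonneg 1
  -- A positive semidefinite form vanishes only on the kernel, and `M 1 = 0` would make every degree
  -- equal to `l`.
  have hne : star (1 : V → ℝ) ⬝ᵥ M.mulVec 1 ≠ 0 := by
    rw [Ne, hpsd.dotProduct_mulVec_zero_iff, hone]
    intro h
    have ha := congrFun h a
    have hb := congrFun h b
    simp only [Pi.zero_apply] at ha hb
    exact hab (by exact_mod_cast (by linarith : (G.degree a : ℝ) = G.degree b))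
  have hpos := lt_of_le_of_ne hnn hne.symm
  rw [hone] at hpos
  simp only [star_one, one_dotProduct, Finset.sum_sub_distrib, Finset.sum_const,
    Finset.card_univ, nsmul_eq_mul] at hpos
  push_cast
  linarith

theorem degree_eq_sum {V : Type*} [Fintype V] (G : SimpleGraph V) [DecidableRel G.Adj] (x : V) :
    G.degree x = ∑ y, if G.Adj x y then 1 else 0 := by
  rw [← card_neighborFinset_eq_degree, neighborFinset_eq_filter, Finset.card_filter]

/-! ### Shortest odd closed walks -/

/-- The shortest odd closed walk of a nonbipartite graph. -/
theorem exists_shortest_odd_closed_walk {V : Type*} {G : SimpleGraph V} (h : ¬ G.IsBipartite) :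
    ∃ (x : V) (p : G.Walk x x), Odd p.length ∧
      ∀ (y : V) (q : G.Walk y y), Odd q.length → p.length ≤ q.length := by
  classical
  have hex : ∃ m : ℕ, ∃ (x : V) (p : G.Walk x x), Odd p.length ∧ p.length = m := by
    by_contra hcon
    refine h (two_colorable_iff_forall_loop_even.2 fun x p => ?_)
    by_contra hp
    exact hcon ⟨_, x, p, Nat.not_even_iff_odd.1 hp, rfl⟩
  obtain ⟨x, p, hp, hpl⟩ := Nat.find_spec hex
  exact ⟨x, p, hp, fun y q hq => hpl ▸ Nat.find_min' hex ⟨y, q, hq, rfl⟩⟩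

theorem Walk.exists_walk_getVert {V : Type*} {G : SimpleGraph V} {x y : V} (p : G.Walk x y)
    (i d : ℕ) (h : i + d ≤ p.length) :
    ∃ q : G.Walk (p.getVert i) (p.getVert (i + d)), q.length = d := by
  induction d with
  | zero => exact ⟨Walk.nil, rfl⟩
  | succ d ih =>
    obtain ⟨q, hq⟩ := ih (by omega)
    exact ⟨q.concat (p.adj_getVert_succ (by omega)), by simp [hq]⟩

/-- A walk joining two vertices of a shortest odd closed walk is not a shortcut. -/
theorem Walk.no_odd_shortcut {V : Type*} {G : SimpleGraph V} {x : V} {p : G.Walk x x}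
    (hmin : ∀ (y : V) (q : G.Walk y y), Odd q.length → p.length ≤ q.length)
    {i d : ℕ} (h : i + d ≤ p.length) (q : G.Walk (p.getVert i) (p.getVert (i + d))) :
    (Odd (d + q.length) → p.length ≤ d + q.length) ∧
      (Odd (p.length - d + q.length) → d ≤ q.length) := by
  obtain ⟨r, hr⟩ := p.exists_walk_getVert i d h
  obtain ⟨r₁, hr₁⟩ := p.exists_walk_getVert 0 i (by omega)
  obtain ⟨r₂, hr₂⟩ := p.exists_walk_getVert (i + d) (p.length - (i + d)) (by omega)
  have e₁ : p.getVert 0 = x := p.getVert_zero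
  have e₂ : p.getVert (i + d + (p.length - (i + d))) = x := by
    rw [Nat.add_sub_cancel' h, p.getVert_length]
  have e₃ : p.getVert (0 + i) = p.getVert i := by rw [zero_add]
  -- Close `q` up with either arc of `p`, of length `d` or `p.length - d`. As `p.length` is odd,
  -- exactly one of the two closed walks is odd.
  have h₁ := hmin _ (r.append q.reverse)
  have h₂ := hmin _ ((q.append (r₂.copy rfl e₂)).append (r₁.copy e₁ e₃))
  simp only [length_append, length_reverse, length_copy, hr, hr₁, hr₂] at h₁ h₂
  refine ⟨h₁, fun ho => ?_⟩
  have := h₂ (by convert ho using 1; omega)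
  omega

section ShortestOddClosedWalk

variable {V : Type*} {G : SimpleGraph V} {x : V} {p : G.Walk x x} (hodd : Odd p.length)
  (hmin : ∀ (y : V) (q : G.Walk y y), Odd q.length → p.length ≤ q.length)
include hodd hmin

/-- A repeated vertex is a shortcut of length 0. -/
theorem Walk.getVert_injOn_of_shortest_odd :
    Set.InjOn p.getVert (Finset.range p.length : Set ℕ) := by
  have key (i j : ℕ) (hij : i < j) (hj : j < p.length) : p.getVert i ≠ p.getVert j := by
    intro he
    obtain ⟨d, rfl⟩ := Nat.exists_eq_add_of_lt hij
    have := no_odd_shortcut hmin (i := i) (d := d + 1) (by omega)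
      ((Walk.nil : G.Walk (p.getVert i) (p.getVert i)).copy rfl he)
    simp only [length_copy, length_nil, Nat.odd_iff] at this hodd
    omega
  intro i hi j hj he
  simp only [Finset.coe_range, Set.mem_Iio] at hi hj
  rcases lt_trichotomy i j with h | h | h
  · exact absurd he (key i j h hj)
  · exact h
  · exact absurd he.symm (key j i h hi)

theorem Walk.cycleGraph_isContained_of_shortest_odd : cycleGraph p.length ⊑ G := by
  refine ⟨⟨⟨fun i => p.getVert i, ?_⟩, ?_⟩⟩
  · have key (a b : Fin p.length) (h : (a - b).val = 1) :
        G.Adj (p.getVert b) (p.getVert a) := by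
      have h2 := a.isLt
      have h3 := b.isLt
      rw [Fin.sub_def] at h
      simp only at h
      by_cases hab : (b : ℕ) ≤ a
      · rw [show p.length - (b : ℕ) + a = (a - b) + p.length by omega, Nat.add_mod_right,
          Nat.mod_eq_of_lt (by omega)] at h
        rw [show (a : ℕ) = b + 1 by omega]
        exact p.adj_getVert_succ h3
      -- The wrap-around edge: here `a = 0` and `b = p.length - 1`.
      · rw [Nat.mod_eq_of_lt (by omega)] at h
        have ha : (a : ℕ) = 0 := by omega
        have := p.adj_getVert_succ h3
        rw [show (b : ℕ) + 1 = p.length by omega, p.getVert_length] at this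
        rw [ha, p.getVert_zero]
        exact this
    intro a b hab
    rcases cycleGraph_adj'.1 hab with h | h
    · exact (key a b h).symm
    · exact key b a h
  · intro a b h
    exact Fin.ext (getVert_injOn_of_shortest_odd hodd hmin (by simp) (by simp) h)

/-- Two neighbors of `v` are joined by a walk of length 2 through `v`, so they lie at cyclic
distance exactly 2. Three positions pairwise at this distance would need a cycle of length 3 or 6.
-/
theorem Walk.card_neighbors_on_shortest_odd_le_two (h5 : 5 ≤ p.length) (v : V)
    [DecidableRel G.Adj] :
    ((Finset.range p.length).filter fun i => G.Adj v (p.getVert i)).card ≤ 2 := by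
  have key (i j : ℕ) (hij : i < j) (hj : j < p.length) (hi' : G.Adj v (p.getVert i))
      (hj' : G.Adj v (p.getVert j)) : j = i + 2 ∨ j + 2 = i + p.length := by
    obtain ⟨d, rfl⟩ := Nat.exists_eq_add_of_lt hij
    have := no_odd_shortcut hmin (i := i) (d := d + 1) (by omega)
      (Walk.cons hi'.symm (Walk.cons hj' Walk.nil))
    simp only [length_cons, length_nil, Nat.odd_iff] at this hodd
    omega
  by_contra! hcon
  obtain ⟨a, b, c, ha, hb, hc, hab, hac, hbc⟩ := Finset.two_lt_card_iff.1 hcon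
  simp only [Finset.mem_filter, Finset.mem_range] at ha hb hc
  have k₁ := fun h => key a b h hb.1 ha.2 hb.2
  have k₂ := fun h => key b a h ha.1 hb.2 ha.2
  have k₃ := fun h => key a c h hc.1 ha.2 hc.2
  have k₄ := fun h => key c a h ha.1 hc.2 ha.2
  have k₅ := fun h => key b c h hc.1 hb.2 hc.2
  have k₆ := fun h => key c b h hb.1 hc.2 hb.2
  rw [Nat.odd_iff] at hodd
  omega

end ShortestOddClosedWalk

/-! ### Counting edges of `G` -/

/-- If every vertex has at most two neighbors in `S` and `G - S` is triangle-free, then Mantel's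
theorem bounds the number of edges of `G`. -/
theorem card_edgeFinset_le_of_neighbors_le_two {V : Type*} [Fintype V] [DecidableEq V]
    {G : SimpleGraph V} [DecidableRel G.Adj] (hG : G.CliqueFree 3) (S : Finset V)
    (hS : ∀ v, (S.filter (G.Adj v)).card ≤ 2) :
    G.edgeFinset.card ≤ Fintype.card V + (Fintype.card V - S.card)
      + (Fintype.card V - S.card) ^ 2 / 4 := by
  have hmantel : 2 * ((G.induce (Sᶜ : Finset V)).edgeFinset.card) =
      ∑ v ∈ Sᶜ, (Sᶜ.filter (G.Adj v)).card := by
    rw [← sum_degrees_eq_twice_card_edges, ← Finset.sum_coe_sort Sᶜ]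
    refine Finset.sum_congr rfl fun v _ => ?_
    rw [degree_eq_sum, Finset.card_filter, ← Finset.sum_coe_sort Sᶜ]
    rfl
  have hle := (CliqueFree.comap (H := G.induce ((Sᶜ : Finset V) : Set V)) (n := 2 + 1)
    ⟨(Embedding.induce _).toCopy⟩ hG).card_edgeFinset_le
  have hcard : Fintype.card (((Sᶜ : Finset V) : Set V)) = Fintype.card V - S.card := by
    rw [← Finset.card_compl]
    exact Fintype.card_coe _
  simp only [hcard] at hle
  have hmantel_le : (G.induce ((Sᶜ : Finset V) : Set V)).edgeFinset.card ≤
      (Fintype.card V - S.card) ^ 2 / 4 := by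
    refine hle.trans ?_
    rcases Nat.mod_two_eq_zero_or_one (Fintype.card V - S.card) with h | h <;> rw [h] <;> simp
    omega
  have hsplit (T : Finset V) : ∑ v ∈ T, G.degree v =
      ∑ v ∈ T, (S.filter (G.Adj v)).card + ∑ v ∈ T, (Sᶜ.filter (G.Adj v)).card := by
    rw [← Finset.sum_add_distrib]
    refine Finset.sum_congr rfl fun v _ => ?_
    rw [degree_eq_sum, Finset.card_filter, Finset.card_filter, Finset.sum_add_sum_compl]
  -- Edges between `S` and its complement enter through `Sᶜ`, so only the bounds on neighbors in `S`
  -- are needed.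
  have hdouble : ∑ v, (Sᶜ.filter (G.Adj v)).card = ∑ v ∈ Sᶜ, G.degree v := by
    simp only [Finset.card_filter, degree_eq_sum]
    rw [Finset.sum_comm]
    simp only [G.adj_comm]
  have hbound (T : Finset V) : ∑ v ∈ T, (S.filter (G.Adj v)).card ≤ T.card * 2 :=
    Finset.sum_le_card_nsmul _ _ _ fun v _ => hS v
  have h₁ := hsplit Finset.univ
  have h₂ := hsplit Sᶜ
  have h₃ := hbound Finset.univ
  have h₄ := hbound Sᶜ
  rw [hdouble, sum_degrees_eq_twice_card_edges] at h₁
  rw [Finset.card_univ] at h₃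
  rw [Finset.card_compl] at h₄
  omega

theorem card_edgeFinset_le_of_odd_cycle_free {V : Type*} [Fintype V] {G : SimpleGraph V}
    [DecidableRel G.Adj] {k : ℕ} (hk : 1 ≤ k)
    (hfree : ∀ i : ℕ, 1 ≤ i → i ≤ k → (cycleGraph (2 * i + 1)).Free G)
    (hbip : ¬ G.IsBipartite) :
    G.edgeFinset.card ≤ Fintype.card V + (Fintype.card V - (2 * k + 3))
      + (Fintype.card V - (2 * k + 3)) ^ 2 / 4 := by
  classical
  obtain ⟨x, p, hodd, hmin⟩ := exists_shortest_odd_closed_walk hbip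
  have hlen : 2 * k + 3 ≤ p.length := by
    by_contra! hlt
    obtain ⟨i, hi⟩ := hodd
    have hc := Walk.cycleGraph_isContained_of_shortest_odd ⟨i, hi⟩ hmin
    rw [hi] at hc
    refine hfree i ?_ (by omega) hc
    -- Length 1 would be a loop.
    by_contra! h0
    have := p.adj_of_length_eq_one (by omega)
    exact G.irrefl this
  have hinj := Walk.getVert_injOn_of_shortest_odd hodd hmin
  have htri : G.CliqueFree 3 := by
    have := hfree 1 le_rfl hk
    rw [show 2 * 1 + 1 = 3 from rfl, cycleGraph_three_eq_top] at this
    rw [cliqueFree_iff]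
    exact ⟨fun f => this ⟨f⟩⟩
  have h := card_edgeFinset_le_of_neighbors_le_two htri ((Finset.range p.length).image p.getVert)
    (fun v => by
      rw [Finset.filter_image]
      exact Finset.card_image_le.trans
        (Walk.card_neighbors_on_shortest_odd_le_two hodd hmin (by omega) v))
  rw [Finset.card_image_of_injOn hinj, Finset.card_range] at h
  -- The bound decreases as the cycle grows.
  refine h.trans ?_
  gcongr

end SimpleGraph

/-! ### Degrees and size of `R_k(K_{s,t})` -/

section GraphR

variable (k : ℕ) {s t : ℕ} (u : Fin s) (v : Fin t)

theorem graphR_adj_left_left (x x' : Fin s) :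
    ¬ (graphR k u v).Adj (Sum.inl (Sum.inl x)) (Sum.inl (Sum.inl x')) := by
  simp [graphR, replaceEdgeByPath]

theorem graphR_adj_right_right (y y' : Fin t) :
    ¬ (graphR k u v).Adj (Sum.inl (Sum.inr y)) (Sum.inl (Sum.inr y')) := by
  simp [graphR, replaceEdgeByPath]

theorem graphR_adj_left_right (x : Fin s) (y : Fin t) :
    (graphR k u v).Adj (Sum.inl (Sum.inl x)) (Sum.inl (Sum.inr y)) ↔ ¬ (x = u ∧ y = v) := by
  simp [graphR, replaceEdgeByPath]

theorem graphR_adj_left_path (x : Fin s) (i : Fin (2 * k - 1)) :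
    (graphR k u v).Adj (Sum.inl (Sum.inl x)) (Sum.inr i) ↔ x = u ∧ (i : ℕ) = 0 := by
  simp [graphR, replaceEdgeByPath]

theorem graphR_adj_right_path (y : Fin t) (i : Fin (2 * k - 1)) :
    (graphR k u v).Adj (Sum.inl (Sum.inr y)) (Sum.inr i) ↔
      y = v ∧ (i : ℕ) + 1 = 2 * k - 1 := by
  simp [graphR, replaceEdgeByPath]

theorem graphR_adj_path_path (i j : Fin (2 * k - 1)) :
    (graphR k u v).Adj (Sum.inr i) (Sum.inr j) ↔ (i : ℕ) + 1 = j ∨ (j : ℕ) + 1 = i :=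
  Iff.rfl

variable [DecidableRel (graphR k u v).Adj]

theorem degree_graphR_left (hk : 1 ≤ k) (x : Fin s) :
    (graphR k u v).degree (Sum.inl (Sum.inl x)) = t := by
  have ht := v.pos
  rw [SimpleGraph.degree_eq_sum]
  simp only [Fintype.sum_sum_type, graphR_adj_left_left, graphR_adj_left_right,
    graphR_adj_left_path]
  by_cases hx : x = u
  · subst hx
    have h₀ : 0 < 2 * k - 1 := by lia
    have h₁ (i : Fin (2 * k - 1)) : (i : ℕ) = 0 ↔ i = ⟨0, h₀⟩ := by simp [Fin.ext_iff]
    have h₂ : (Finset.univ.filter fun y : Fin t => ¬ y = v).card = t - 1 := by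
      rw [Finset.filter_not, Finset.filter_eq', if_pos (Finset.mem_univ _),
        Finset.card_sdiff_of_subset (by simp)]
      simp
    simp [h₁, Finset.sum_ite, h₂, Nat.sub_add_cancel ht]
  · simp [hx]

theorem degree_graphR_right (hk : 1 ≤ k) (y : Fin t) :
    (graphR k u v).degree (Sum.inl (Sum.inr y)) = s := by
  have hs := u.pos
  rw [SimpleGraph.degree_eq_sum]
  simp only [Fintype.sum_sum_type,
    (graphR k u v).adj_comm (Sum.inl (Sum.inr y)) (Sum.inl (Sum.inl _)), graphR_adj_right_right,
    graphR_adj_left_right, graphR_adj_right_path]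
  by_cases hy : y = v
  · subst hy
    have h₀ : 2 * k - 2 < 2 * k - 1 := by lia
    have h₁ (i : Fin (2 * k - 1)) : (i : ℕ) + 1 = 2 * k - 1 ↔ i = ⟨2 * k - 2, h₀⟩ := by
      simp only [Fin.ext_iff]
      omega
    have h₂ : (Finset.univ.filter fun x : Fin s => ¬ x = u).card = s - 1 := by
      rw [Finset.filter_not, Finset.filter_eq', if_pos (Finset.mem_univ _),
        Finset.card_sdiff_of_subset (by simp)]
      simp
    simp [h₁, Finset.sum_ite, h₂, Nat.sub_add_cancel hs]
  · simp [hy]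

theorem degree_graphR_path (i : Fin (2 * k - 1)) :
    (graphR k u v).degree (Sum.inr i) = 2 := by
  have hi := i.isLt
  have hnext : (∑ j : Fin (2 * k - 1), if (i : ℕ) + 1 = j then 1 else 0) =
      if (i : ℕ) + 1 = 2 * k - 1 then 0 else 1 := by
    split_ifs with h
    · exact Finset.sum_eq_zero fun j _ => if_neg (by omega)
    · rw [Finset.sum_eq_single ⟨i + 1, by omega⟩ (fun j _ hj => if_neg fun he =>
        hj (Fin.ext he.symm)) (by simp)]
      simp
  have hprev : (∑ j : Fin (2 * k - 1), if (j : ℕ) + 1 = i then 1 else 0) =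
      if (i : ℕ) = 0 then 0 else 1 := by
    split_ifs with h
    · exact Finset.sum_eq_zero fun j _ => if_neg (by omega)
    · rw [Finset.sum_eq_single ⟨i - 1, by omega⟩ (fun j _ hj => if_neg fun he =>
        hj (Fin.ext (by simp; omega))) (by simp)]
      exact if_pos (by simp; omega)
  have hpath : (∑ j : Fin (2 * k - 1), if (i : ℕ) + 1 = j ∨ (j : ℕ) + 1 = i then 1 else 0) =
      (∑ j : Fin (2 * k - 1), if (i : ℕ) + 1 = j then 1 else 0) +
        ∑ j : Fin (2 * k - 1), if (j : ℕ) + 1 = i then 1 else 0 := by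
    rw [← Finset.sum_add_distrib]
    refine Finset.sum_congr rfl fun j _ => ?_
    split_ifs <;> omega
  rw [SimpleGraph.degree_eq_sum]
  simp only [Fintype.sum_sum_type, (graphR k u v).adj_comm (Sum.inr i) (Sum.inl _),
    graphR_adj_left_path, graphR_adj_right_path, graphR_adj_path_path, ite_and,
    Finset.sum_ite_eq', Finset.mem_univ, if_true]
  rw [hpath, hnext, hprev]
  split_ifs <;> rfl

theorem sum_degree_graphR (hk : 1 ≤ k) :
    ∑ x, (graphR k u v).degree x = 2 * (s * t + (2 * k - 1)) := by
  simp only [Fintype.sum_sum_type, degree_graphR_left k u v hk, degree_graphR_right k u v hk,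
    degree_graphR_path, Finset.sum_const, Finset.card_univ, Fintype.card_fin, smul_eq_mul]
  ring

end GraphR

/-! ### Comparison of the two edge counts -/

theorem mainTheorem7 (k : ℕ) (hk : 1 ≤ k) (n : ℕ) (hn : 2 * k + 4 ≤ n)
    {V : Type*} [Fintype V] (hV : Fintype.card V = n)
    (G : SimpleGraph V) [DecidableRel G.Adj]
    (hfree : ∀ i : ℕ, 1 ≤ i → i ≤ k → (SimpleGraph.cycleGraph (2 * i + 1)).Free G)
    (hbip : ¬ G.IsBipartite)
    (u : Fin ((n - 2 * k + 1) / 2)) (v : Fin ((n - 2 * k + 1) ⌈/⌉ 2)) :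
    (G.edgeFinset.card : ℝ) < (n : ℝ) / 2 * lambdaOne (graphR k u v) := by
  classical
  have hceil : (n - 2 * k + 1) ⌈/⌉ 2 = (n - 2 * k + 2) / 2 := Nat.ceilDiv_eq_add_pred_div _ _
  have hG := SimpleGraph.card_edgeFinset_le_of_odd_cycle_free hk hfree hbip
  -- Not regular: `u` has degree `⌈(n - 2k + 1)/2⌉ ≥ 3`, path vertices have degree 2.
  have hR := (graphR k u v).sum_degree_lt_card_mul_lambdaOne
    (a := Sum.inl (Sum.inl u)) (b := Sum.inr ⟨0, by omega⟩) (by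
      rw [degree_graphR_left k u v hk, degree_graphR_path, hceil]
      omega)
  rw [sum_degree_graphR k u v hk] at hR
  have hcard : Fintype.card ((Fin ((n - 2 * k + 1) / 2) ⊕ Fin ((n - 2 * k + 1) ⌈/⌉ 2)) ⊕
      Fin (2 * k - 1)) = n := by
    simp only [Fintype.card_sum, Fintype.card_fin, hceil]
    omega
  have hle : G.edgeFinset.card ≤
      (n - 2 * k + 1) / 2 * ((n - 2 * k + 1) ⌈/⌉ 2) + (2 * k - 1) := by
    -- With `m = n - 2k - 3` both sides agree, since `⌊(m + 4)²/4⌋ = ⌊m²/4⌋ + 2m + 4`; parity of `m`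
    -- decides the floors.
    refine hG.trans ?_
    rw [hV, hceil]
    obtain ⟨a, rfl⟩ := Nat.exists_eq_add_of_le hn
    rw [show 2 * k + 4 + a - (2 * k + 3) = a + 1 by omega,
      show 2 * k + 4 + a - 2 * k + 1 = a + 5 by omega,
      show 2 * k + 4 + a - 2 * k + 2 = a + 6 by omega]
    obtain ⟨b, rfl | rfl⟩ := Nat.even_or_odd' a
    · rw [show (2 * b + 5) / 2 = b + 2 by omega, show (2 * b + 6) / 2 = b + 3 by omega,
        show (2 * b + 1) ^ 2 = 1 + (b * b + b) * 4 by ring,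
        Nat.add_mul_div_right _ _ (by norm_num)]
      ring_nf
      omega
    · rw [show (2 * b + 1 + 5) / 2 = b + 3 by omega, show (2 * b + 1 + 6) / 2 = b + 3 by omega,
        show (2 * b + 1 + 1) ^ 2 = (b * b + 2 * b + 1) * 4 by ring,
        Nat.mul_div_cancel _ (by norm_num)]
      ring_nf
      omega
  rw [hcard] at hR
  have hle' : (G.edgeFinset.card : ℝ) ≤
      ((n - 2 * k + 1) / 2 * ((n - 2 * k + 1) ⌈/⌉ 2) + (2 * k - 1) : ℕ) := by exact_mod_cast hle
  rw [Nat.cast_mul, Nat.cast_ofNat] at hR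
  linarith
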